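/- Let $\Bbbk$ be a field and let $2\le a\le b$ be integers. Let $S=\Bbbk[x_1,\dots,x_a,x'_1,\dots,x'_b,y'_1,\dots,y'_a,y_1,\dots,y_b]$ and let $<$ be the graded lexicographic order on $S$ with respect to $$x_1>\cdots>x_a>x'_1>\cdots>x'_b>y'_1>\cdots>y'_a>y_1>\cdots>y_b .$$ For $1\le i\le a$, $1\le j\le b$ put $f_{ij}=x_iy_j-x'_jy'_i$, and for $1\le i<i'\le a$, $1\le j'<j\le b$ put $f_{ii'j'j}=f_{ij'}f_{i'j}-f_{ij}f_{i'j'}$. Let $$\mathcal G_{a,b}=\{f_{ij}: 1\le i\le a,\ 1\le j\le b\}\cup\{f_{ii'j'j}: 1\le i<i'\le a,\ 1\le j'<j\le b\}.$$ The binomial edge ring $\mathcal R(G)$ of a graph $G$ is the $\Bbbk$-algebra generated by the binomials $x_uy_v-x_vy_u$, $\{u,v\}\in E(G)$, in the polynomial ring in the variables $x_v,y_v$ $(v\in V(G))$; for the complete bipartite graph $K_{a,b}$ the variables of the $i$-th vertex of the first side are called $x_i,y'_i$ and those of the $j$-th vertex of the second side $x'_j,y_j$, so that $\mathcal R(K_{a,b})\subset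 S$. A set $\mathcal F$ of polynomials is a SAGBI basis of a subalgebra $A\subset S$ with respect to $<$ if $\mathcal F$ generates $A$ and the initial algebra of $A$, generated by the initial monomials of all nonzero elements of $A$, is generated by the initial monomials of the nonzero elements of $\mathcal F$. **Then:** (1) $\mathcal G_{a,b}$ is a SAGBI basis of $\mathcal R(K_{a,b})$ with respect to $<$. (2) Let $R_{a,b}$ be the polynomial ring over $\Bbbk$ in the variables $z_{ij}$ $(1\le i\le a,\ 1\le j\le b)$ and $z_{ii'j'j}$ $(1\le i<i'\le a,\ 1\le j'<j\le b)$, and let $I$ be the kernel of the $\Bbbk$-algebra homomorphism $R_{a,b}\to S$, $z_{ij}\mapsto f_{ij}$, $z_{ii'j'j}\mapsto f_{ii'j'j}$. Then $I=J$, where $J$ is the ideal of $R_{a,b}$ generated by the following polynomials, for all $i,i',p,p'\in\{1,\dots,a\}$ and $j,j',q,q'\in\{1,\dots,b\}$ subject to the conditions stated and to those of $i<i'$, $p<p'$, $j'<j$, $q'<q$ both of whose indices occur in a four-index variable of the first monomial of the polynomial: $$\begin{aligned} &z_{ij}z_{pq}-z_{iq}z_{pj}-z_{ipjq} && (i<p,\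 j<q);\\ &z_{ij}z_{pp'q'q}-z_{pq}z_{ip'q'j}+z_{iq'}z_{pp'qj}+z_{p'j}z_{ipq'q}+z_{p'q'}z_{ipqj} && (i<p,\ q<j);\\ &z_{ij}z_{pp'q'q}-z_{iq}z_{pp'q'j}+z_{iq'}z_{pp'qj} && (p\le i,\ q<j);\\ &z_{ij}z_{pp'q'q}-z_{pj}z_{ip'q'q}+z_{p'j}z_{ipq'q} && (i<p,\ j\le q);\\ &z_{ii'j'j}z_{pp'q'q}-z_{ii'q'q}z_{pp'j'j} && (i\le p,\ i'\le p',\ j'\le q',\ j\le q);\\ &z_{ii'j'j}z_{pp'q'q}-z_{pi'q'q}z_{ip'j'j}+z_{piq'q}z_{i'p'j'j} && (i>p,\ i'<p',\ j'\le q',\ j\le q);\\ &z_{ii'j'j}z_{pp'q'q}-z_{ip'q'q}z_{pi'j'j}+z_{p'i'j'j}z_{ipq'q} && (i<p,\ i'>p',\ j'\le q',\ j\le q);\\ &z_{ii'j'j}z_{pp'q'q}-z_{ii'j'q}z_{pp'q'j}+z_{ii'jq}z_{pp'q'j'} && (i\le p,\ i'\le p',\ j'>q',\ j<q);\\ &z_{ii'j'j}z_{pp'q'q}-z_{ii'q'j}z_{pp'j'q}+z_{ii'j'q'}z_{pp'qj}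 && (i\le p,\ i'\le p',\ j'<q',\ j>q);\\ &z_{ii'j'j}z_{pp'q'q}-z_{pi'j'q}z_{ip'q'j}+z_{pij'q}z_{i'p'q'j}+z_{ip'jq}z_{pi'q'j'}-z_{i'p'jq}z_{piq'j'} && (i>p,\ i'<p',\ j'>q',\ j<q);\\ &z_{ii'j'j}z_{pp'q'q}-z_{pi'j'q}z_{ip'q'j}+z_{ipq'j}z_{p'i'j'q}+z_{pi'qj}z_{ip'j'q'}-z_{p'i'qj}z_{ipj'q'} && (i<p,\ i'>p',\ j'<q',\ j>q);\\ &z_{ii'j'j}z_{pp'q'q}-z_{pi'q'j}z_{ip'j'q}+z_{piq'j}z_{i'p'j'q}+z_{ip'qj}z_{pi'j'q'}-z_{i'p'qj}z_{pij'q'} && (i>p,\ i'<p',\ j'<q',\ j>q);\\ &z_{ii'j'j}z_{pp'q'q}-z_{pi'q'j}z_{ip'j'q}+z_{ipj'q}z_{p'i'q'j}+z_{pi'jq}z_{ip'q'j'}-z_{p'i'jq}z_{ipq'j'} && (i<p,\ i'>p',\ j'>q',\ j<q). \end{aligned}$$ -/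

import Mathlib

noncomputable section

namespace BinomialEdge

open MvPolynomial

section Sagbi

variable {σ : Type*} {k : Type*} [Field k]

/-- The set of initial monomials `in_<(g)` (with coefficient one) of the nonzero elements `g`
of a set of polynomials. -/
def initialMonomials (m : MonomialOrder σ) (F : Set (MvPolynomial σ k)) :
    Set (MvPolynomial σ k) :=
  {p | ∃ g ∈ F, g ≠ 0 ∧ p = monomial (m.degree g) 1}

/-- The initial algebra `in_<(A)`: the subalgebra generated by the initial monomials of the
nonzero elements of `A`. -/
def initialAlgebra (m : MonomialOrder σ) (A : Subalgebra k (MvPolynomial σ k)) :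
    Subalgebra k (MvPolynomial σ k) :=
  Algebra.adjoin k (initialMonomials m (A : Set (MvPolynomial σ k)))

/-- `F` is a SAGBI basis of the subalgebra `A`: `F` generates `A`, and the initial algebra of `A`
is generated by the initial monomials of the elements of `F`. -/
def IsSagbiBasis (m : MonomialOrder σ) (F : Set (MvPolynomial σ k))
    (A : Subalgebra k (MvPolynomial σ k)) : Prop :=
  Algebra.adjoin k F = A ∧ initialAlgebra m A = Algebra.adjoin k (initialMonomials m F)

end Sagbi

section EdgeRing

/-- The variables of the ambient ring of the binomial edge ring of a graph on `V`: two copies of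
`V`, the first one for the `x`-variables and the second one for the `y`-variables.  The linear
order is the lexicographic sum, so every `x`-index precedes every `y`-index. -/
abbrev Var (V : Type*) := V ⊕ₗ V

variable (k : Type*) [Field k] {V : Type*}

/-- The variable `x_v`. -/
def xVar (v : V) : MvPolynomial (Var V) k := X (toLex (Sum.inl v))

/-- The variable `y_v`. -/
def yVar (v : V) : MvPolynomial (Var V) k := X (toLex (Sum.inr v))

/-- The binomial `f_{uv} = x_u y_v - x_v y_u`. -/
def edgeBinomial (u v : V) : MvPolynomial (Var V) k :=
  xVar k u * yVar k v - xVar k v * yVar k u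

/-- The binomial edge ring of `G`, generated by the binomials of its edges.  (An edge `{u, v}`
contributes `f_{uv}` and `f_{vu} = -f_{uv}`, so no orientation has to be chosen.) -/
def binomialEdgeRing (G : SimpleGraph V) : Subalgebra k (MvPolynomial (Var V) k) :=
  Algebra.adjoin k {p | ∃ u v, G.Adj u v ∧ p = edgeBinomial k u v}

end EdgeRing

section CompleteBipartite

/-- The vertices of `K_{a,b}`, linearly ordered with the `a` vertices of the first side in front
of the `b` vertices of the second side. -/
abbrev Vert (a b : ℕ) := Fin a ⊕ₗ Fin b

/-- The complete bipartite graph `K_{a,b}`. -/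
def completeBipartite (a b : ℕ) : SimpleGraph (Vert a b) :=
  (completeBipartiteGraph (Fin a) (Fin b)).comap ofLex

/-- The graded lexicographic order.  In `MonomialOrder.degLex` a smaller index means a larger
variable; writing `x_i, y'_i` for the two variables of the `i`-th vertex of the first side and
`x'_j, y_j` for those of the `j`-th vertex of the second side, the variables are therefore ordered
`x_1 > ⋯ > x_a > x'_1 > ⋯ > x'_b > y'_1 > ⋯ > y'_a > y_1 > ⋯ > y_b`. -/
def order (a b : ℕ) : MonomialOrder (Var (Vert a b)) := MonomialOrder.degLex

variable (k : Type*) [Field k] {a b : ℕ}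

/-- `x_i`, for `i` on the first side. -/
def x (i : Fin a) : MvPolynomial (Var (Vert a b)) k := xVar k (toLex (Sum.inl i))

/-- `x'_j`, for `j` on the second side. -/
def x' (j : Fin b) : MvPolynomial (Var (Vert a b)) k := xVar k (toLex (Sum.inr j))

/-- `y'_i`, for `i` on the first side. -/
def y' (i : Fin a) : MvPolynomial (Var (Vert a b)) k := yVar k (toLex (Sum.inl i))

/-- `y_j`, for `j` on the second side. -/
def y (j : Fin b) : MvPolynomial (Var (Vert a b)) k := yVar k (toLex (Sum.inr j))

/-- `f_{ij} = x_i y_j - x'_j y'_i`. -/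
def f (i : Fin a) (j : Fin b) : MvPolynomial (Var (Vert a b)) k :=
  x k i * y k j - x' k j * y' k i

/-- `f_{ii'j'j} = f_{ij'} f_{i'j} - f_{ij} f_{i'j'}`. -/
def quartic (i i' : Fin a) (j' j : Fin b) : MvPolynomial (Var (Vert a b)) k :=
  f k i j' * f k i' j - f k i j * f k i' j'

variable (a b) in
/-- The set `G_{a,b}`. -/
def sagbiSet : Set (MvPolynomial (Var (Vert a b)) k) :=
  {p | ∃ (i : Fin a) (j : Fin b), p = f k i j} ∪
    {p | ∃ (i i' : Fin a) (j' j : Fin b), i < i' ∧ j' < j ∧ p = quartic k i i' j' j}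

/-- Indices of the variables `z_{ij}` and `z_{ii'j'j}` (`i < i'`, `j' < j`) of the ring that
presents `k[G_{a,b}]`. -/
inductive PresVar (a b : ℕ) : Type
  | pair (i : Fin a) (j : Fin b) : PresVar a b
  | quad (i i' : Fin a) (j' j : Fin b) (hi : i < i') (hj : j' < j) : PresVar a b

/-- The variable `z_{ij}`. -/
def z (i : Fin a) (j : Fin b) : MvPolynomial (PresVar a b) k := X (.pair i j)

/-- The variable `z_{ii'j'j}`; the two inequalities are found from the context. -/
def zz (i i' : Fin a) (j' j : Fin b) (hi : i < i' := by omega) (hj : j' < j := by omega) :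
    MvPolynomial (PresVar a b) k :=
  X (.quad i i' j' j hi hj)

variable (a b) in
/-- The presentation map, `z_{ij} ↦ f_{ij}` and `z_{ii'j'j} ↦ f_{ii'j'j}`. -/
def presentationMap :
    MvPolynomial (PresVar a b) k →ₐ[k] MvPolynomial (Var (Vert a b)) k :=
  aeval fun
    | .pair i j => f k i j
    | .quad i i' j' j _ _ => quartic k i i' j' j

set_option maxHeartbeats 1000000 in
/-- The explicit list of generators of the ideal `J`. -/
inductive IsGenerator : MvPolynomial (PresVar a b) k → Prop
  | rel1 (i p : Fin a) (j q : Fin b) (h₁ : i < p) (h₂ : j < q) :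
      IsGenerator (z k i j * z k p q - z k i q * z k p j - zz k i p j q)
  | rel2 (i p p' : Fin a) (j q' q : Fin b) (hp : p < p') (hq : q' < q)
      (h₁ : i < p) (h₂ : q < j) :
      IsGenerator (z k i j * zz k p p' q' q - z k p q * zz k i p' q' j
        + z k i q' * zz k p p' q j + z k p' j * zz k i p q' q + z k p' q' * zz k i p q j)
  | rel3 (i p p' : Fin a) (j q' q : Fin b) (hp : p < p') (hq : q' < q)
      (h₁ : p ≤ i) (h₂ : q < j) :
      IsGenerator (z k i j * zz k p p' q' q - z k i q * zz k p p' q' j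
        + z k i q' * zz k p p' q j)
  | rel4 (i p p' : Fin a) (j q' q : Fin b) (hp : p < p') (hq : q' < q)
      (h₁ : i < p) (h₂ : j ≤ q) :
      IsGenerator (z k i j * zz k p p' q' q - z k p j * zz k i p' q' q
        + z k p' j * zz k i p q' q)
  | rel5 (i i' p p' : Fin a) (j' j q' q : Fin b)
      (hi : i < i') (hp : p < p') (hj : j' < j) (hq : q' < q)
      (h₁ : i ≤ p) (h₂ : i' ≤ p') (h₃ : j' ≤ q') (h₄ : j ≤ q) :
      IsGenerator (zz k i i' j' j * zz k p p' q' q - zz k i i' q' q * zz k p p' j' j)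
  | rel6 (i i' p p' : Fin a) (j' j q' q : Fin b)
      (hi : i < i') (hp : p < p') (hj : j' < j) (hq : q' < q)
      (h₁ : i > p) (h₂ : i' < p') (h₃ : j' ≤ q') (h₄ : j ≤ q) :
      IsGenerator (zz k i i' j' j * zz k p p' q' q - zz k p i' q' q * zz k i p' j' j
        + zz k p i q' q * zz k i' p' j' j)
  | rel7 (i i' p p' : Fin a) (j' j q' q : Fin b)
      (hi : i < i') (hp : p < p') (hj : j' < j) (hq : q' < q)
      (h₁ : i < p) (h₂ : i' > p') (h₃ : j' ≤ q') (h₄ : j ≤ q) :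
      IsGenerator (zz k i i' j' j * zz k p p' q' q - zz k i p' q' q * zz k p i' j' j
        + zz k p' i' j' j * zz k i p q' q)
  | rel8 (i i' p p' : Fin a) (j' j q' q : Fin b)
      (hi : i < i') (hp : p < p') (hj : j' < j) (hq : q' < q)
      (h₁ : i ≤ p) (h₂ : i' ≤ p') (h₃ : j' > q') (h₄ : j < q) :
      IsGenerator (zz k i i' j' j * zz k p p' q' q - zz k i i' j' q * zz k p p' q' j
        + zz k i i' j q * zz k p p' q' j')
  | rel9 (i i' p p' : Fin a) (j' j q' q : Fin b)
      (hi : i < i') (hp : p < p') (hj : j' < j) (hq : q' < q)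
      (h₁ : i ≤ p) (h₂ : i' ≤ p') (h₃ : j' < q') (h₄ : j > q) :
      IsGenerator (zz k i i' j' j * zz k p p' q' q - zz k i i' q' j * zz k p p' j' q
        + zz k i i' j' q' * zz k p p' q j)
  | rel10 (i i' p p' : Fin a) (j' j q' q : Fin b)
      (hi : i < i') (hp : p < p') (hj : j' < j) (hq : q' < q)
      (h₁ : i > p) (h₂ : i' < p') (h₃ : j' > q') (h₄ : j < q) :
      IsGenerator (zz k i i' j' j * zz k p p' q' q - zz k p i' j' q * zz k i p' q' j
        + zz k p i j' q * zz k i' p' q' j + zz k i p' j q * zz k p i' q' j'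
        - zz k i' p' j q * zz k p i q' j')
  | rel11 (i i' p p' : Fin a) (j' j q' q : Fin b)
      (hi : i < i') (hp : p < p') (hj : j' < j) (hq : q' < q)
      (h₁ : i < p) (h₂ : i' > p') (h₃ : j' < q') (h₄ : j > q) :
      IsGenerator (zz k i i' j' j * zz k p p' q' q - zz k p i' j' q * zz k i p' q' j
        + zz k i p q' j * zz k p' i' j' q + zz k p i' q j * zz k i p' j' q'
        - zz k p' i' q j * zz k i p j' q')
  | rel12 (i i' p p' : Fin a) (j' j q' q : Fin b)
      (hi : i < i') (hp : p < p') (hj : j' < j) (hq : q' < q)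
      (h₁ : i > p) (h₂ : i' < p') (h₃ : j' < q') (h₄ : j > q) :
      IsGenerator (zz k i i' j' j * zz k p p' q' q - zz k p i' q' j * zz k i p' j' q
        + zz k p i q' j * zz k i' p' j' q + zz k i p' q j * zz k p i' j' q'
        - zz k i' p' q j * zz k p i j' q')
  | rel13 (i i' p p' : Fin a) (j' j q' q : Fin b)
      (hi : i < i') (hp : p < p') (hj : j' < j) (hq : q' < q)
      (h₁ : i < p) (h₂ : i' > p') (h₃ : j' > q') (h₄ : j < q) :
      IsGenerator (zz k i i' j' j * zz k p p' q' q - zz k p i' q' j * zz k i p' j' q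
        + zz k i p j' q * zz k p' i' q' j + zz k p i' j q * zz k i p' q' j'
        - zz k p' i' j q * zz k i p q' j')

variable (a b) in
/-- The ideal `J`. -/
def relationIdeal : Ideal (MvPolynomial (PresVar a b) k) := Ideal.span {g | IsGenerator k g}

end CompleteBipartite

end BinomialEdge

end

/-!
Each `f_{ii'j'j}` factors as `(x_i y'_{i'} - x_{i'} y'_i) (x'_{j'} y_j - x'_j y_{j'})`, so its
initial monomial is `x_i y'_{i'} x'_{j'} y_j`, while that of `f_{ij}` is `x_i y_j`.  The generators are
partially ordered by comparing all their indices at once (`key`), those of the first side increasing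
and those of the second side decreasing; a monomial in the presentation ring is *standard* if its
variables are pairwise comparable.  Two facts carry the proof.

* Distinct standard monomials have images with distinct initial monomials (`injOn_standard`): the
  least variable of a standard monomial is read off from the initial monomial, then cancelled.
* The standard monomials span the presentation ring modulo `J` (`relationIdeal_sup_standard`): the
  listed generators of `J` have as their first terms all products of two incomparable variables
  (`straightens_of_incomparable`).  In each of them another term, if it has the same initial
  monomial in `S` as the first, is the product of the componentwise minimum and maximum of the two
  variables, and otherwise it has a smaller one.  Both kinds of terms have smaller `straightWeight`
  than the first term, which makes straightening terminate.

As the relations hold, `J` is contained in the kernel.  A polynomial in the kernel is congruent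
modulo `J` to a combination of standard monomials in the kernel, and that combination is zero because its
initial monomials cannot cancel.  By the same token, the initial monomial of an arbitrary element
of the algebra is that of the image of a standard monomial, so a product of initial
monomials of generators.
-/

noncomputable section

namespace BinomialEdge

open MvPolynomial

/-! ### Leading monomials of the generators -/

section Leading

variable {σ : Type*} {k : Type*} [Field k] {m : MonomialOrder σ}

/-- `p` has initial monomial `d`, with coefficient one. -/
def HasLead (m : MonomialOrder σ) (p : MvPolynomial σ k) (d : σ →₀ ℕ) : Prop :=
  m.Monic p ∧ m.degree p = d

lemma HasLead.mul {p q : MvPolynomial σ k} {d e : σ →₀ ℕ} (hp : HasLead m p d)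
    (hq : HasLead m q e) : HasLead m (p * q) (d + e) :=
  ⟨hp.1.mul hq.1, by rw [m.degree_mul hp.1.ne_zero hq.1.ne_zero, hp.2, hq.2]⟩

lemma HasLead.pow {p : MvPolynomial σ k} {d : σ →₀ ℕ} (hp : HasLead m p d) (n : ℕ) :
    HasLead m (p ^ n) (n • d) :=
  ⟨hp.1.pow, by rw [m.degree_pow, hp.2]⟩

lemma HasLead.prod {ι : Type*} {s : Finset ι} {p : ι → MvPolynomial σ k} {d : ι → σ →₀ ℕ}
    (h : ∀ i ∈ s, HasLead m (p i) (d i)) : HasLead m (∏ i ∈ s, p i) (∑ i ∈ s, d i) :=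
  ⟨MonomialOrder.Monic.prod fun i hi => (h i hi).1, by
    rw [m.degree_prod fun i hi => (h i hi).1.ne_zero]
    exact Finset.sum_congr rfl fun i hi => (h i hi).2⟩

lemma hasLead_X (v : σ) : HasLead m (X v : MvPolynomial σ k) (Finsupp.single v 1) :=
  ⟨MonomialOrder.monic_X, MonomialOrder.degree_X⟩

lemma HasLead.sub {p q : MvPolynomial σ k} {d e : σ →₀ ℕ} (hp : HasLead m p d)
    (hq : HasLead m q e) (h : m.toSyn e < m.toSyn d) : HasLead m (p - q) d := by
  have h' : m.toSyn (m.degree q) < m.toSyn (m.degree p) := by rwa [hp.2, hq.2]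
  refine ⟨?_, by rw [m.degree_sub_of_lt h', hp.2]⟩
  rw [MonomialOrder.Monic, m.leadingCoeff_sub_of_lt h']
  exact hp.1

/-- In the graded lexicographic order the initial monomial of a binomial of degree two is the one
that contains the largest variable. -/
lemma hasLead_binomial [LinearOrder σ] [WellFoundedGT σ] {u v u' v' : σ} (h₁ : u < u')
    (h₂ : u < v') :
    HasLead MonomialOrder.degLex (X u * X v - X u' * X v' : MvPolynomial σ k)
      (Finsupp.single u 1 + Finsupp.single v 1) := by
  refine ((hasLead_X u).mul (hasLead_X v)).sub ((hasLead_X u').mul (hasLead_X v')) ?_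
  rw [MonomialOrder.degLex_lt_iff, Finsupp.DegLex.lt_iff]
  right
  refine ⟨by simp, ?_⟩
  -- the first variable at which the two monomials differ is `min u v`
  refine ⟨min u v, fun d hd => ?_, ?_⟩
  · have hu : d < u := hd.trans_le (min_le_left _ _)
    have hv : d < v := hd.trans_le (min_le_right _ _)
    simp [hu.ne', hv.ne', (hu.trans h₁).ne', (hu.trans h₂).ne']
  · have h1 : u' ≠ min u v := ((min_le_left _ _).trans_lt h₁).ne'
    have h2 : v' ≠ min u v := ((min_le_left _ _).trans_lt h₂).ne'
    rcases le_total u v with h | h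
    · simp_all
    · simp_all

/-- An algebra homomorphism that maps every variable `X s` to a polynomial with initial monomial
`w s` maps a monomial to a polynomial with the corresponding product as initial monomial. -/
lemma hasLead_aeval_monomial {τ : Type*} {g : τ → MvPolynomial σ k} {w : τ → σ →₀ ℕ}
    (h : ∀ s, HasLead m (g s) (w s)) (M : τ →₀ ℕ) :
    HasLead m (aeval g (monomial M (1 : k))) (Finsupp.weight w M) := by
  rw [aeval_monomial, map_one, one_mul, Finsupp.weight_apply]
  exact HasLead.prod fun s _ => (h s).pow _

/-- If the initial monomials of the images of the monomials in `T` are pairwise distinct, then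
the initial monomial of the image of a nonzero combination of these monomials is the initial
monomial of the image of one of them; in particular, that image is not zero. -/
lemma exists_degree_aeval_eq {τ : Type*} {g : τ → MvPolynomial σ k} {w : τ → σ →₀ ℕ}
    (h : ∀ s, HasLead m (g s) (w s)) {T : Set (τ →₀ ℕ)}
    (hT : Set.InjOn (Finsupp.weight (R := ℕ) w) T)
    {N : MvPolynomial τ k} (hN : N ∈ restrictSupport k T) (hN0 : N ≠ 0) :
    aeval g N ≠ 0 ∧ ∃ M : τ →₀ ℕ, m.degree (aeval g N) = Finsupp.weight w M := by
  classical
  have hsupp : ∀ M ∈ N.support, M ∈ T := fun M hM => (mem_restrictSupport_iff k).mp hN hM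
  obtain ⟨M₀, hM₀, hmax⟩ := N.support.exists_max_image
    (fun M => m.toSyn (Finsupp.weight w M)) (support_nonempty.mpr hN0)
  have hsum : aeval g N = ∑ M ∈ N.support, C (N.coeff M) * aeval g (monomial M (1 : k)) := by
    conv_lhs => rw [N.as_sum]
    rw [map_sum]
    refine Finset.sum_congr rfl fun M _ => ?_
    rw [← mul_one (N.coeff M), ← C_mul_monomial, map_mul, mul_one, ← algebraMap_eq,
      AlgHom.commutes, ← algebraMap_eq]
  have hcoeff : coeff (Finsupp.weight w M₀) (aeval g N) = N.coeff M₀ := by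
    rw [hsum, coeff_sum, Finset.sum_eq_single M₀]
    · have := hasLead_aeval_monomial h M₀
      have h1 := this.1.coeff_degree
      rw [this.2] at h1
      rw [coeff_C_mul, h1, mul_one]
    · intro M hM hne
      rw [coeff_C_mul, m.coeff_eq_zero_of_lt, mul_zero]
      rw [(hasLead_aeval_monomial h M).2]
      exact lt_of_le_of_ne (hmax M hM) fun he =>
        hne (hT (hsupp M hM) (hsupp M₀ hM₀) (m.toSyn.injective he))
    · exact fun hn => absurd hM₀ hn
  have hmem : Finsupp.weight w M₀ ∈ (aeval g N).support := by
    rw [mem_support_iff, hcoeff]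
    exact mem_support_iff.mp hM₀
  refine ⟨fun h0 => by rw [h0] at hmem; simp at hmem, M₀,
    m.toSyn.injective (le_antisymm ?_ (m.le_degree hmem))⟩
  rw [hsum]
  refine m.degree_sum_le.trans (Finset.sup_le fun M hM => ?_)
  refine m.degree_mul_le.trans ?_
  rw [m.degree_C, zero_add, (hasLead_aeval_monomial h M).2]
  exact hmax M hM

end Leading

section Presentation

variable (k : Type*) [Field k] {a b : ℕ}

/-- The index of the variable `x_i`. -/
abbrev xi (i : Fin a) : Var (Vert a b) := toLex (Sum.inl (toLex (Sum.inl i)))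
/-- The index of the variable `x'_j`. -/
abbrev xi' (j : Fin b) : Var (Vert a b) := toLex (Sum.inl (toLex (Sum.inr j)))
/-- The index of the variable `y'_i`. -/
abbrev yi' (i : Fin a) : Var (Vert a b) := toLex (Sum.inr (toLex (Sum.inl i)))
/-- The index of the variable `y_j`. -/
abbrev yi (j : Fin b) : Var (Vert a b) := toLex (Sum.inr (toLex (Sum.inr j)))

lemma quartic_eq (i i' : Fin a) (j' j : Fin b) :
    quartic k i i' j' j =
      (x k i * y' k i' - x k i' * y' k i) * (x' k j' * y k j - x' k j * y k j') := by
  simp only [quartic, f]; ring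

/-- The initial monomial `x_i y_j` of `f_{ij}`, respectively `x_i y'_{i'} x'_{j'} y_j` of
`f_{ii'j'j}`. -/
def initMonomial : PresVar a b → Var (Vert a b) →₀ ℕ
  | .pair i j => Finsupp.single (xi i) 1 + Finsupp.single (yi j) 1
  | .quad i i' j' j _ _ => Finsupp.single (xi i) 1 + Finsupp.single (yi' i') 1 +
      (Finsupp.single (xi' j') 1 + Finsupp.single (yi j) 1)

/-- The image of a variable under the presentation map. -/
def presentationImage : PresVar a b → MvPolynomial (Var (Vert a b)) k
  | .pair i j => f k i j
  | .quad i i' j' j _ _ => quartic k i i' j' j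

lemma presentationMap_eq : presentationMap k a b = aeval (presentationImage k) := by
  unfold presentationMap
  rfl

lemma hasLead_presentationImage (s : PresVar a b) :
    HasLead (order a b) (presentationImage k s) (initMonomial s) := by
  cases s with
  | pair i j =>
    exact hasLead_binomial (k := k) (u := xi i) (v := yi j) (u' := xi' j) (v' := yi' i)
      (by simp) (by simp)
  | quad i i' j' j hi hj =>
    rw [presentationImage, quartic_eq]
    refine HasLead.mul ?_ ?_
    · exact hasLead_binomial (k := k) (u := xi i) (v := yi' i') (u' := xi i') (v' := yi' i)
        (by simp [hi]) (by simp)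
    · exact hasLead_binomial (k := k) (u := xi' j') (v := yi j) (u' := xi' j) (v' := yi j')
        (by simp [hj]) (by simp)

/-! ### Standard monomials -/

/-- The coordinates by which the generators are compared.  The indices of the second side enter
with a minus sign, and for `z_{ij}` the two missing inner coordinates are larger than
those of all four-index variables. -/
def key : PresVar a b → ℤ × ℤ × ℤ × ℤ
  | .pair i j => (i, a, 1, -j)
  | .quad i i' j' j _ _ => (i, i', -j', -j)

@[simp] lemma key_pair (i : Fin a) (j : Fin b) :
    key (.pair i j : PresVar a b) = ((i : ℤ), (a : ℤ), 1, -(j : ℤ)) := rfl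

@[simp] lemma key_quad (i i' : Fin a) (j' j : Fin b) (hi : i < i') (hj : j' < j) :
    key (.quad i i' j' j hi hj : PresVar a b) = ((i : ℤ), (i' : ℤ), -(j' : ℤ), -(j : ℤ)) := rfl

lemma key_injective : Function.Injective (key : PresVar a b → _) := by
  rintro (⟨i, j⟩ | ⟨i, i', j', j, hi, hj⟩) (⟨p, q⟩ | ⟨p, p', q', q, hp, hq⟩) h <;>
    simp at h
  · obtain ⟨h1, h2⟩ := h
    congr <;> omega
  · omega
  · omega
  · obtain ⟨h1, h2, h3, h4⟩ := h
    congr <;> omega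

instance : PartialOrder (PresVar a b) := PartialOrder.lift key key_injective

lemma presVar_le_def {s t : PresVar a b} : s ≤ t ↔ key s ≤ key t := Iff.rfl

variable (a b) in
/-- The standard monomials: products of pairwise comparable variables. -/
def standard : Set (PresVar a b →₀ ℕ) := {M | IsChain (· ≤ ·) (M.support : Set (PresVar a b))}

lemma weight_apply_ne_zero {τ υ : Type*} (w : τ → υ →₀ ℕ) (M : τ →₀ ℕ) (v : υ) :
    Finsupp.weight w M v ≠ 0 ↔ ∃ s ∈ M.support, w s v ≠ 0 := by
  rw [Finsupp.weight_apply, Finsupp.sum, Finsupp.finsetSum_apply, ← Nat.pos_iff_ne_zero,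
    Finset.sum_pos_iff]
  refine exists_congr fun s => and_congr_right fun hs => ?_
  rw [Finsupp.smul_apply, smul_eq_mul, Nat.pos_iff_ne_zero, mul_ne_zero_iff]
  exact and_iff_right (Finsupp.mem_support_iff.mp hs)

/-- If two monomials have the same image under `initMonomial`, a lower bound of the variables of one
is a lower bound of those of the other: the initial monomial shows which values each of the four
coordinates takes, apart from the values reserved for the variables `z_{ij}`, which are the
largest ones. -/
lemma le_of_weight_eq {M M' : PresVar a b →₀ ℕ}
    (h : Finsupp.weight initMonomial M = Finsupp.weight initMonomial M') {s s' : PresVar a b}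
    (hs : s ∈ M.support) (hs' : ∀ t ∈ M'.support, s' ≤ t) : s' ≤ s := by
  have occ : ∀ v, initMonomial s v ≠ 0 → ∃ t ∈ M'.support, initMonomial t v ≠ 0 := fun v hv =>
    (weight_apply_ne_zero _ _ _).mp (h ▸ (weight_apply_ne_zero _ _ _).mpr ⟨s, hs, hv⟩)
  have key_le : ∀ t ∈ M'.support, (key s').1 ≤ (key t).1 ∧ (key s').2.1 ≤ (key t).2.1 ∧
    (key s').2.2.1 ≤ (key t).2.2.1 ∧ (key s').2.2.2 ≤ (key t).2.2.2 := fun t ht => hs' t ht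
  have hx : ∀ i, initMonomial s (xi i) ≠ 0 → (key s').1 ≤ i := by
    intro i hi
    obtain ⟨t, ht, hti⟩ := occ _ hi
    have := (key_le t ht).1
    cases t <;> simp [initMonomial, Finsupp.single_apply] at hti this <;> simp_all
  have hy : ∀ j, initMonomial s (yi j) ≠ 0 → (key s').2.2.2 ≤ -j := by
    intro j hj
    obtain ⟨t, ht, htj⟩ := occ _ hj
    have := (key_le t ht).2.2.2
    cases t <;> simp [initMonomial, Finsupp.single_apply] at htj this <;> simp_all
  have hy' : ∀ i, initMonomial s (yi' i) ≠ 0 → (key s').2.1 ≤ i := by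
    intro i hi
    obtain ⟨t, ht, hti⟩ := occ _ hi
    have := (key_le t ht).2.1
    cases t <;> simp [initMonomial, Finsupp.single_apply] at hti this
    simp_all
  have hx' : ∀ j, initMonomial s (xi' j) ≠ 0 → (key s').2.2.1 ≤ -j := by
    intro j hj
    obtain ⟨t, ht, htj⟩ := occ _ hj
    have := (key_le t ht).2.2.1
    cases t <;> simp [initMonomial, Finsupp.single_apply] at htj this
    simp_all
  have bounds : (key s').2.1 ≤ a ∧ (key s').2.2.1 ≤ 1 := by
    cases s' <;> simp
  cases s with
  | pair i j =>
    exact ⟨hx i (by simp [initMonomial]), bounds.1, bounds.2, hy j (by simp [initMonomial])⟩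
  | quad i i' j' j hi hj =>
    exact ⟨hx i (by simp [initMonomial]), hy' i' (by simp [initMonomial]),
      hx' j' (by simp [initMonomial]), hy j (by simp [initMonomial])⟩

lemma exists_least {M : PresVar a b →₀ ℕ} (hM : M ∈ standard a b) (h0 : M ≠ 0) :
    ∃ s ∈ M.support, ∀ t ∈ M.support, s ≤ t := by
  obtain ⟨s, hs⟩ := M.support.exists_minimal (Finsupp.support_nonempty_iff.mpr h0)
  refine ⟨s, hs.1, fun t ht => ?_⟩
  by_cases hst : s = t
  · exact hst.le
  · exact (hM hs.1 ht hst).elim id fun hts => hs.2 ht hts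

lemma initMonomial_ne_zero (s : PresVar a b) : initMonomial s ≠ 0 := by
  cases s <;> simp [initMonomial]

lemma weight_initMonomial_eq_zero {M : PresVar a b →₀ ℕ}
    (h : Finsupp.weight initMonomial M = 0) : M = 0 := by
  by_contra h0
  obtain ⟨s, hs⟩ := Finsupp.support_nonempty_iff.mpr h0
  obtain ⟨v, hv⟩ := Finsupp.ne_iff.mp (initMonomial_ne_zero s)
  exact (weight_apply_ne_zero _ _ _).mpr ⟨s, hs, hv⟩ (by rw [h]; rfl)

/-- Distinct standard monomials have images with distinct initial monomials: the least
variable can be read off and cancelled. -/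
lemma injOn_standard : Set.InjOn (Finsupp.weight initMonomial) (standard a b) := by
  intro M hM M' hM' h
  induction hn : M.degree generalizing M M' with
  | zero =>
    obtain rfl := (Finsupp.degree_eq_zero_iff M).mp hn
    rw [map_zero] at h
    exact (weight_initMonomial_eq_zero h.symm).symm
  | succ n ih =>
    have hM0 : M ≠ 0 := by rintro rfl; simp at hn
    have hM'0 : M' ≠ 0 := by
      rintro rfl
      rw [map_zero] at h
      exact hM0 (weight_initMonomial_eq_zero h)
    obtain ⟨s, hs, hs_le⟩ := exists_least hM hM0
    obtain ⟨s', hs', hs'_le⟩ := exists_least hM' hM'0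
    obtain rfl : s = s' := le_antisymm (le_of_weight_eq h.symm hs' hs_le)
      (le_of_weight_eq h hs hs'_le)
    have hle : ∀ {K : PresVar a b →₀ ℕ}, s ∈ K.support → ∃ L, K = Finsupp.single s 1 + L :=
      fun {K} hK => exists_add_of_le (Finsupp.single_le_iff.mpr
        (Nat.one_le_iff_ne_zero.mpr (Finsupp.mem_support_iff.mp hK)))
    have hsub : ∀ {K L : PresVar a b →₀ ℕ}, K = Finsupp.single s 1 + L → K ∈ standard a b →
        L ∈ standard a b := fun {K L} hKL hK => IsChain.mono (Finset.coe_subset.mpr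
      (Finsupp.support_mono (by rw [hKL]; exact le_add_self))) hK
    obtain ⟨L, hL⟩ := hle hs
    obtain ⟨L', hL'⟩ := hle hs'
    have hw : Finsupp.weight initMonomial L = Finsupp.weight initMonomial L' := by
      rw [hL, hL', map_add, map_add] at h
      exact add_left_cancel h
    have hd : L.degree = n := by
      rw [hL, map_add, Finsupp.degree_single] at hn
      omega
    rw [hL, hL', ih (hsub hL hM) (hsub hL' hM') hw hd]

end Presentation

section Straightening

variable (k : Type*) [Field k] {a b : ℕ}

/-! ### The relations hold -/

lemma presentationMap_z (i : Fin a) (j : Fin b) : presentationMap k a b (z k i j) = f k i j :=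
  aeval_X _ _

lemma presentationMap_zz (i i' : Fin a) (j' j : Fin b) (hi : i < i') (hj : j' < j) :
    presentationMap k a b (zz k i i' j' j hi hj) = quartic k i i' j' j :=
  aeval_X _ _

variable {k} in
lemma presentationMap_isGenerator {g : MvPolynomial (PresVar a b) k} (hg : IsGenerator k g) :
    presentationMap k a b g = 0 := by
  cases hg <;>
    simp only [map_add, map_sub, map_mul, presentationMap_z, presentationMap_zz, quartic_eq, f] <;>
    ring

lemma relationIdeal_le_ker : relationIdeal k a b ≤ RingHom.ker (presentationMap k a b) :=
  Ideal.span_le.mpr fun _ hg => presentationMap_isGenerator hg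

/-! ### Straightening -/

/-- A linear weight that represents the monomial order on the initial monomials that occur in the
relations: with indices counted from zero, it gives `x_i` the weight `a + b + 1 - i`, `x'_j` the
weight `b - j`, and the other variables the weight zero. -/
def orderWeight : PresVar a b → ℕ
  | .pair i _ => a + b + 1 - i
  | .quad i _ j' _ _ _ => a + b + 1 - i + (b - j')

/-- The sum of the coordinates of `key`, shifted so that it is nonnegative. -/
def keySum : PresVar a b → ℕ
  | .pair i j => i + a + (b + 1) + (b - j)
  | .quad i i' j' j _ _ => i + i' + (b - j') + (b - j)

/-- The weight that decreases under straightening.  The dominant term is `orderWeight`.  Exchanging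
two variables for their componentwise minimum and maximum does not change it, but spreads the values
of `keySum` and so increases the sum of their squares. -/
def straightWeight (s : PresVar a b) : ℕ :=
  (2 * (2 * (a + b + 1)) ^ 2 + 1) * orderWeight s + ((2 * (a + b + 1)) ^ 2 - keySum s ^ 2)

lemma keySum_le (s : PresVar a b) : keySum s ≤ 2 * (a + b + 1) := by
  cases s <;> simp only [keySum] <;> omega

lemma straightWeight_lt_of_orderWeight_lt {s t u v : PresVar a b}
    (h : orderWeight u + orderWeight v < orderWeight s + orderWeight t) :
    straightWeight u + straightWeight v < straightWeight s + straightWeight t := by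
  unfold straightWeight
  set B := (2 * (a + b + 1)) ^ 2
  have hu : B - keySum u ^ 2 ≤ B := Nat.sub_le _ _
  have hv : B - keySum v ^ 2 ≤ B := Nat.sub_le _ _
  have := Nat.mul_le_mul_left (2 * B + 1) (Nat.succ_le_of_lt h)
  simp only [Nat.succ_eq_add_one, Nat.mul_add] at this
  omega

lemma straightWeight_lt_of_orderWeight_lt' {s t u : PresVar a b}
    (h : orderWeight u < orderWeight s + orderWeight t) :
    straightWeight u < straightWeight s + straightWeight t := by
  unfold straightWeight
  set B := (2 * (a + b + 1)) ^ 2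
  have hu : B - keySum u ^ 2 ≤ B := Nat.sub_le _ _
  have := Nat.mul_le_mul_left (2 * B + 1) (Nat.succ_le_of_lt h)
  simp only [Nat.succ_eq_add_one, Nat.mul_add] at this
  omega

lemma straightWeight_lt_of_keySum_lt {s t u v : PresVar a b}
    (h : orderWeight u + orderWeight v = orderWeight s + orderWeight t)
    (h' : keySum u + keySum v = keySum s + keySum t)
    (h₁ : keySum u < keySum s ∧ keySum u < keySum t ∨ keySum v < keySum s ∧ keySum v < keySum t) :
    straightWeight u + straightWeight v < straightWeight s + straightWeight t := by
  have hs := Nat.pow_le_pow_left (keySum_le s) 2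
  have ht := Nat.pow_le_pow_left (keySum_le t) 2
  have hu := Nat.pow_le_pow_left (keySum_le u) 2
  have hv := Nat.pow_le_pow_left (keySum_le v) 2
  unfold straightWeight
  set B := (2 * (a + b + 1)) ^ 2
  have key : keySum s ^ 2 + keySum t ^ 2 < keySum u ^ 2 + keySum v ^ 2 := by
    rcases h₁ with ⟨h1, h2⟩ | ⟨h1, h2⟩
    · obtain ⟨c, hc⟩ := Nat.exists_eq_add_of_lt h1
      obtain ⟨d, hd⟩ := Nat.exists_eq_add_of_lt h2
      have hv' : keySum v = keySum u + (c + 1) + (d + 1) := by omega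
      rw [hc, hd, hv']
      nlinarith
    · obtain ⟨c, hc⟩ := Nat.exists_eq_add_of_lt h1
      obtain ⟨d, hd⟩ := Nat.exists_eq_add_of_lt h2
      have hv' : keySum u = keySum v + (c + 1) + (d + 1) := by omega
      rw [hc, hd, hv']
      nlinarith
  have := congrArg (fun n => (2 * B + 1) * n) h
  simp only [Nat.mul_add] at this
  omega

/-- The polynomials in the presentation ring all of whose monomials have weight less than `n`. -/
def lowWeight (a b n : ℕ) : Submodule k (MvPolynomial (PresVar a b) k) :=
  restrictSupport k {M | Finsupp.weight straightWeight M < n}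

variable {k}

lemma X_mem_lowWeight {s : PresVar a b} {n : ℕ} (h : straightWeight s < n) :
    (X s : MvPolynomial (PresVar a b) k) ∈ lowWeight k a b n :=
  (monomial_mem_restrictSupport k).mpr (Or.inl (by simpa [Finsupp.weight_single] using h))

lemma X_mul_X_mem_lowWeight {s t : PresVar a b} {n : ℕ}
    (h : straightWeight s + straightWeight t < n) :
    (X s * X t : MvPolynomial (PresVar a b) k) ∈ lowWeight k a b n := by
  rw [X, X, monomial_mul]
  exact (monomial_mem_restrictSupport k).mpr (Or.inl (by simpa [Finsupp.weight_single] using h))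

section Tail

-- These lemmas take a relation `g` apart whose first term `p` is left out.
variable {A : Type*} [AddCommGroup A] [Module k A] {W : Submodule k A} {p g h : A}

lemma sub_self_mem : p - p ∈ W := by simp

lemma sub_sub_mem (hg : p - g ∈ W) (hh : h ∈ W) : p - (g - h) ∈ W := by
  rw [sub_sub_eq_add_sub, add_sub_right_comm]
  exact W.add_mem hg hh

lemma sub_add_mem (hg : p - g ∈ W) (hh : h ∈ W) : p - (g + h) ∈ W := by
  rw [← sub_sub]
  exact W.sub_mem hg hh

end Tail

variable (k) in
/-- The product of the variables `s` and `t` is the leading term of one of the generators of `J`. -/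
def Straightens (s t : PresVar a b) : Prop :=
  ∃ g, IsGenerator k g ∧
    (X s * X t : MvPolynomial (PresVar a b) k) - g ∈
      lowWeight k a b (straightWeight s + straightWeight t)

lemma straightens_pair_pair {i p : Fin a} {j q : Fin b} (h₁ : i < p) (h₂ : j < q) :
    Straightens k (.pair i j) (.pair p q) := by
  refine ⟨_, .rel1 i p j q h₁ h₂, sub_sub_mem (sub_sub_mem sub_self_mem ?_) ?_⟩
  · apply X_mul_X_mem_lowWeight
    apply straightWeight_lt_of_keySum_lt <;> simp only [orderWeight, keySum] <;> omega
  · apply X_mem_lowWeight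
    apply straightWeight_lt_of_orderWeight_lt'
    simp only [orderWeight]
    omega

lemma straightens_pair_quad {i p p' : Fin a} {j q' q : Fin b} (hp : p < p') (hq : q' < q)
    (h : i < p ∨ q < j) : Straightens k (.pair i j) (.quad p p' q' q hp hq) := by
  by_cases h₁ : i < p <;> by_cases h₂ : q < j
  · refine ⟨_, .rel2 i p p' j q' q hp hq h₁ h₂, sub_add_mem (sub_add_mem (sub_add_mem
      (sub_sub_mem sub_self_mem ?_) ?_) ?_) ?_⟩ <;> apply X_mul_X_mem_lowWeight
    · apply straightWeight_lt_of_keySum_lt <;> simp only [orderWeight, keySum] <;> omega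
    all_goals apply straightWeight_lt_of_orderWeight_lt; simp only [orderWeight]; omega
  · refine ⟨_, .rel4 i p p' j q' q hp hq h₁ (not_lt.mp h₂),
      sub_add_mem (sub_sub_mem sub_self_mem ?_) ?_⟩ <;> apply X_mul_X_mem_lowWeight
    · apply straightWeight_lt_of_keySum_lt <;> simp only [orderWeight, keySum] <;> omega
    all_goals apply straightWeight_lt_of_orderWeight_lt; simp only [orderWeight]; omega
  · refine ⟨_, .rel3 i p p' j q' q hp hq (not_lt.mp h₁) h₂,
      sub_add_mem (sub_sub_mem sub_self_mem ?_) ?_⟩ <;> apply X_mul_X_mem_lowWeight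
    · apply straightWeight_lt_of_keySum_lt <;> simp only [orderWeight, keySum] <;> omega
    all_goals apply straightWeight_lt_of_orderWeight_lt; simp only [orderWeight]; omega
  · omega

/-- Incomparable four-index variables are straightened in this order if each of the two index pairs
of the first is equal to, componentwise below, nested in, or wrapped around that of the second.
The relations are only listed for these cases, since the remaining ones arise by exchanging the
two variables. -/
lemma straightens_quad_quad {i i' p p' : Fin a} {j' j q' q : Fin b}
    (hi : i < i') (hj : j' < j) (hp : p < p') (hq : q' < q)
    (hA : i ≤ p ∧ i' ≤ p' ∨ p < i ∧ i' < p' ∨ i < p ∧ p' < i')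
    (hB : j' ≤ q' ∧ j ≤ q ∨ q' < j' ∧ j < q ∨ j' < q' ∧ q < j)
    (h : ¬ (i ≤ p ∧ i' ≤ p' ∧ q' ≤ j' ∧ q ≤ j)) (h' : ¬ (p ≤ i ∧ p' ≤ i' ∧ j' ≤ q' ∧ j ≤ q)) :
    Straightens k (.quad i i' j' j hi hj) (.quad p p' q' q hp hq) := by
  rcases hA with ⟨h₁, h₂⟩ | ⟨h₁, h₂⟩ | ⟨h₁, h₂⟩ <;> rcases hB with ⟨h₃, h₄⟩ | ⟨h₃, h₄⟩ | ⟨h₃, h₄⟩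
  · refine ⟨_, .rel5 i i' p p' j' j q' q hi hp hj hq h₁ h₂ h₃ h₄, sub_sub_mem sub_self_mem ?_⟩
    apply X_mul_X_mem_lowWeight
    apply straightWeight_lt_of_keySum_lt <;> simp only [orderWeight, keySum] <;> omega
  · refine ⟨_, .rel8 i i' p p' j' j q' q hi hp hj hq h₁ h₂ h₃ h₄,
      sub_add_mem (sub_sub_mem sub_self_mem ?_) ?_⟩ <;> apply X_mul_X_mem_lowWeight
    · apply straightWeight_lt_of_keySum_lt <;> simp only [orderWeight, keySum] <;> omega
    · apply straightWeight_lt_of_orderWeight_lt; simp only [orderWeight]; omega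
  · refine ⟨_, .rel9 i i' p p' j' j q' q hi hp hj hq h₁ h₂ h₃ h₄,
      sub_add_mem (sub_sub_mem sub_self_mem ?_) ?_⟩ <;> apply X_mul_X_mem_lowWeight
    · apply straightWeight_lt_of_keySum_lt <;> simp only [orderWeight, keySum] <;> omega
    · apply straightWeight_lt_of_orderWeight_lt; simp only [orderWeight]; omega
  · refine ⟨_, .rel6 i i' p p' j' j q' q hi hp hj hq h₁ h₂ h₃ h₄,
      sub_add_mem (sub_sub_mem sub_self_mem ?_) ?_⟩ <;> apply X_mul_X_mem_lowWeight
    · apply straightWeight_lt_of_keySum_lt <;> simp only [orderWeight, keySum] <;> omega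
    · apply straightWeight_lt_of_orderWeight_lt; simp only [orderWeight]; omega
  · refine ⟨_, .rel10 i i' p p' j' j q' q hi hp hj hq h₁ h₂ h₃ h₄, sub_sub_mem (sub_add_mem
      (sub_add_mem (sub_sub_mem sub_self_mem ?_) ?_) ?_) ?_⟩ <;> apply X_mul_X_mem_lowWeight
    · apply straightWeight_lt_of_keySum_lt <;> simp only [orderWeight, keySum] <;> omega
    all_goals apply straightWeight_lt_of_orderWeight_lt; simp only [orderWeight]; omega
  · refine ⟨_, .rel12 i i' p p' j' j q' q hi hp hj hq h₁ h₂ h₃ h₄, sub_sub_mem (sub_add_mem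
      (sub_add_mem (sub_sub_mem sub_self_mem ?_) ?_) ?_) ?_⟩ <;> apply X_mul_X_mem_lowWeight
    · apply straightWeight_lt_of_keySum_lt <;> simp only [orderWeight, keySum] <;> omega
    all_goals apply straightWeight_lt_of_orderWeight_lt; simp only [orderWeight]; omega
  · refine ⟨_, .rel7 i i' p p' j' j q' q hi hp hj hq h₁ h₂ h₃ h₄,
      sub_add_mem (sub_sub_mem sub_self_mem ?_) ?_⟩ <;> apply X_mul_X_mem_lowWeight
    · apply straightWeight_lt_of_keySum_lt <;> simp only [orderWeight, keySum] <;> omega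
    · apply straightWeight_lt_of_orderWeight_lt; simp only [orderWeight]; omega
  · refine ⟨_, .rel13 i i' p p' j' j q' q hi hp hj hq h₁ h₂ h₃ h₄, sub_sub_mem (sub_add_mem
      (sub_add_mem (sub_sub_mem sub_self_mem ?_) ?_) ?_) ?_⟩ <;> apply X_mul_X_mem_lowWeight
    · apply straightWeight_lt_of_keySum_lt <;> simp only [orderWeight, keySum] <;> omega
    all_goals apply straightWeight_lt_of_orderWeight_lt; simp only [orderWeight]; omega
  · refine ⟨_, .rel11 i i' p p' j' j q' q hi hp hj hq h₁ h₂ h₃ h₄, sub_sub_mem (sub_add_mem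
      (sub_add_mem (sub_sub_mem sub_self_mem ?_) ?_) ?_) ?_⟩ <;> apply X_mul_X_mem_lowWeight
    · apply straightWeight_lt_of_keySum_lt <;> simp only [orderWeight, keySum] <;> omega
    all_goals apply straightWeight_lt_of_orderWeight_lt; simp only [orderWeight]; omega

/-- The product of any two incomparable variables is the leading term of a generator of `J`. -/
lemma straightens_of_incomparable {s t : PresVar a b} (h : ¬ s ≤ t) (h' : ¬ t ≤ s) :
    Straightens k s t ∨ Straightens k t s := by
  rcases s with ⟨i, j⟩ | ⟨i, i', j', j, hi, hj⟩ <;>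
    rcases t with ⟨p, q⟩ | ⟨p, p', q', q, hp, hq⟩ <;>
    simp only [presVar_le_def, key_pair, key_quad, Prod.mk_le_mk] at h h'
  · rcases lt_or_ge i p with hip | hip
    · exact Or.inl (straightens_pair_pair hip (by omega))
    · exact Or.inr (straightens_pair_pair (by omega) (by omega))
  · exact Or.inl (straightens_pair_quad hp hq (by omega))
  · exact Or.inr (straightens_pair_quad hi hj (by omega))
  · by_cases hAB : (p ≤ i ∧ p' ≤ i' ∧ ¬ (i = p ∧ i' = p')) ∨
        (q' ≤ j' ∧ q ≤ j ∧ ¬ (j' = q' ∧ j = q))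
    · exact Or.inr (straightens_quad_quad hp hq hi hj (by omega) (by omega) (by omega) (by omega))
    · exact Or.inl (straightens_quad_quad hi hj hp hq (by omega) (by omega) (by omega) (by omega))

variable (k) in
/-- Modulo `J`, every polynomial is a linear combination of standard monomials. -/
lemma relationIdeal_sup_standard :
    (relationIdeal k a b).restrictScalars k ⊔ restrictSupport k (standard a b) = ⊤ := by
  set W := (relationIdeal k a b).restrictScalars k ⊔ restrictSupport k (standard a b)
  have hmon : ∀ M, monomial M (1 : k) ∈ W := by
    intro M
    induction hn : Finsupp.weight straightWeight M using Nat.strong_induction_on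
      generalizing M with
    | _ n ih =>
    by_cases hM : M ∈ standard a b
    · exact Submodule.mem_sup_right ((monomial_mem_restrictSupport k).mpr (Or.inl hM))
    obtain ⟨s, hs, t, ht, hst, hS⟩ : ∃ s ∈ M.support, ∃ t ∈ M.support, s ≠ t ∧
        Straightens k s t := by
      simp only [standard, IsChain, Set.Pairwise, Set.mem_ofPred_eq, not_forall, not_or] at hM
      obtain ⟨s, hs, t, ht, hne, h1, h2⟩ := hM
      rcases straightens_of_incomparable (k := k) h1 h2 with h | h
      · exact ⟨s, hs, t, ht, hne, h⟩
      · exact ⟨t, ht, s, hs, hne.symm, h⟩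
    obtain ⟨L, hL⟩ : ∃ L, M = Finsupp.single s 1 + Finsupp.single t 1 + L := by
      refine exists_add_of_le fun v => ?_
      have h1 := Nat.pos_of_ne_zero (Finsupp.mem_support_iff.mp hs)
      have h2 := Nat.pos_of_ne_zero (Finsupp.mem_support_iff.mp ht)
      classical
      simp only [Finsupp.add_apply, Finsupp.single_apply]
      split_ifs <;> simp_all <;> omega
    obtain ⟨g, hg, hlow⟩ := hS
    -- multiply the relation by the remaining factor of the monomial
    have hprod : monomial M (1 : k) = g * monomial L 1 + (X s * X t - g) * monomial L 1 := by
      rw [hL, ← add_mul, add_sub_cancel, X, X, monomial_mul, monomial_mul]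
      simp
    rw [hprod]
    refine W.add_mem (Submodule.mem_sup_left ?_) ?_
    · exact Ideal.mul_mem_right _ _ (Ideal.subset_span hg)
    · rw [lowWeight, restrictSupport_eq_span] at hlow
      generalize (X s * X t - g : MvPolynomial (PresVar a b) k) = Q at hlow
      induction hlow using Submodule.span_induction with
      | mem x hx =>
        obtain ⟨K, hK, rfl⟩ := hx
        simp only [monomial_mul, mul_one]
        refine ih _ ?_ _ rfl
        rw [← hn, hL]
        simp only [map_add, Finsupp.weight_single, one_smul]
        exact Nat.add_lt_add_right hK _
      | zero => rw [zero_mul]; exact W.zero_mem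
      | add x y _ _ hx hy => rw [add_mul]; exact W.add_mem hx hy
      | smul c x _ hx => rw [smul_mul_assoc]; exact W.smul_mem c hx
  refine eq_top_iff.mpr fun N _ => ?_
  rw [N.as_sum]
  refine W.sum_mem fun M _ => ?_
  rw [← mul_one (N.coeff M), ← smul_eq_mul, ← smul_monomial]
  exact W.smul_mem _ (hmon M)

/-! ### The presentation and the SAGBI basis -/

variable (k) in
/-- Every polynomial has the same image as a combination of standard monomials from which it differs
by an element of `J`. -/
lemma exists_standard (P : MvPolynomial (PresVar a b) k) :
    ∃ N ∈ restrictSupport k (standard a b),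
      P - N ∈ relationIdeal k a b ∧ presentationMap k a b P = presentationMap k a b N := by
  have hP : P ∈ (relationIdeal k a b).restrictScalars k ⊔ restrictSupport k (standard a b) := by
    rw [relationIdeal_sup_standard]; trivial
  obtain ⟨r, hr, N, hN, rfl⟩ := Submodule.mem_sup.mp hP
  refine ⟨N, hN, by simpa using hr, ?_⟩
  have h0 : presentationMap k a b r = 0 := relationIdeal_le_ker k hr
  rw [map_add, h0, zero_add]

variable (k a b)

lemma ker_presentationMap : RingHom.ker (presentationMap k a b) = relationIdeal k a b := by
  refine le_antisymm (fun P hP => ?_) (relationIdeal_le_ker k)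
  obtain ⟨N, hN, hPN, hmap⟩ := exists_standard k P
  have hN0 : N = 0 := by
    by_contra h
    refine (exists_degree_aeval_eq (hasLead_presentationImage k) injOn_standard hN h).1 ?_
    rw [← presentationMap_eq, ← hmap]
    exact hP
  simpa [hN0] using hPN

lemma range_presentationImage : Set.range (presentationImage k) = sagbiSet k a b := by
  ext p
  constructor
  · rintro ⟨s, rfl⟩
    cases s with
    | pair i j => exact Or.inl ⟨i, j, rfl⟩
    | quad i i' j' j hi hj => exact Or.inr ⟨i, i', j', j, hi, hj, rfl⟩
  · rintro (⟨i, j, rfl⟩ | ⟨i, i', j', j, hi, hj, rfl⟩)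
    · exact ⟨.pair i j, rfl⟩
    · exact ⟨.quad i i' j' j hi hj, rfl⟩

lemma adjoin_sagbiSet :
    Algebra.adjoin k (sagbiSet k a b) = binomialEdgeRing k (completeBipartite a b) := by
  have hf : ∀ i j, f k i j ∈ binomialEdgeRing k (completeBipartite a b) := fun i j =>
    Algebra.subset_adjoin ⟨toLex (Sum.inl i), toLex (Sum.inr j), by simp [completeBipartite], rfl⟩
  apply le_antisymm
  · refine Algebra.adjoin_le ?_
    rintro p (⟨i, j, rfl⟩ | ⟨i, i', j', j, hi, hj, rfl⟩)
    · exact hf i j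
    · exact sub_mem (mul_mem (hf _ _) (hf _ _)) (mul_mem (hf _ _) (hf _ _))
  · refine Algebra.adjoin_le ?_
    rintro p ⟨u, v, huv, rfl⟩
    have hf' : ∀ i j, f k i j ∈ Algebra.adjoin k (sagbiSet k a b) := fun i j =>
      Algebra.subset_adjoin (Or.inl ⟨i, j, rfl⟩)
    obtain ⟨i | j, rfl⟩ := toLex.surjective u <;> obtain ⟨i' | j', rfl⟩ := toLex.surjective v <;>
      simp [completeBipartite] at huv
    · exact hf' i j'
    · have : edgeBinomial k (V := Vert a b) (toLex (Sum.inr j)) (toLex (Sum.inl i')) =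
          - f k i' j := by
        simp only [edgeBinomial, f, x, y, x', y']; ring
      rw [this]
      exact neg_mem (hf' i' j)

/-- The initial monomial of the image of a monomial is a product of initial monomials of the
generators. -/
lemma monomial_weight_mem (M : PresVar a b →₀ ℕ) :
    monomial (Finsupp.weight initMonomial M) (1 : k) ∈
      Algebra.adjoin k (initialMonomials (order a b) (sagbiSet k a b)) := by
  rw [Finsupp.weight_apply, Finsupp.sum, monomial_sum_one]
  refine Subalgebra.prod_mem _ fun s _ => ?_
  rw [← one_pow (M s), ← monomial_pow]
  refine pow_mem (Algebra.subset_adjoin ?_) _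
  refine ⟨presentationImage k s, ?_, (hasLead_presentationImage k s).1.ne_zero, ?_⟩
  · rw [← range_presentationImage]; exact ⟨s, rfl⟩
  · rw [(hasLead_presentationImage k s).2]

lemma initialAlgebra_binomialEdgeRing :
    initialAlgebra (order a b) (binomialEdgeRing k (completeBipartite a b)) =
      Algebra.adjoin k (initialMonomials (order a b) (sagbiSet k a b)) := by
  rw [← adjoin_sagbiSet]
  apply le_antisymm
  · refine Algebra.adjoin_le ?_
    rintro p ⟨g, hg, hg0, rfl⟩
    rw [← range_presentationImage, Algebra.adjoin_range_eq_range_aeval, ← presentationMap_eq] at hg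
    obtain ⟨P, rfl⟩ := hg
    obtain ⟨N, hN, -, hmap⟩ := exists_standard k P
    change presentationMap k a b P ≠ 0 at hg0
    change monomial ((order a b).degree (presentationMap k a b P)) 1 ∈ _
    rw [hmap] at hg0 ⊢
    obtain ⟨-, M, hM⟩ := exists_degree_aeval_eq (hasLead_presentationImage k) injOn_standard hN
      (by rintro rfl; simp at hg0)
    rw [presentationMap_eq, hM]
    exact monomial_weight_mem k a b M
  · refine Algebra.adjoin_mono ?_
    rintro p ⟨g, hg, hg0, rfl⟩
    exact ⟨g, Algebra.subset_adjoin hg, hg0, rfl⟩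

end Straightening

end BinomialEdge

end

theorem theorem1p1 (k : Type*) [Field k] (a b : ℕ) (ha : 2 ≤ a) (hab : a ≤ b) :
    BinomialEdge.IsSagbiBasis (BinomialEdge.order a b) (BinomialEdge.sagbiSet k a b)
        (BinomialEdge.binomialEdgeRing k (BinomialEdge.completeBipartite a b)) ∧
      RingHom.ker (BinomialEdge.presentationMap k a b) = BinomialEdge.relationIdeal k a b :=
  ⟨⟨BinomialEdge.adjoin_sagbiSet k a b, BinomialEdge.initialAlgebra_binomialEdgeRing k a b⟩,
    BinomialEdge.ker_presentationMap k a b⟩
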